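/- Let $n=2m$ be a positive even integer, $\varepsilon=e^{2\pi i/n}$, and let $\mathbb D_n$ be the dicyclic group of order $2n$ generated by $g,h$ with relations $g^n=h^4=ghgh^{-1}=1$, $g^m=h^2$. It acts by algebra automorphisms on the free algebra $\mathbb C\langle x,y\rangle$ by $g\cdot x=\varepsilon x$, $g\cdot y=\varepsilon^{-1}y$, $h\cdot x=y$, $h\cdot y=-x$. Let $c=\sum_{i=0}^{n-1}c_ig^i$ be an element of the center of $\mathbb C[\mathbb D_n]$ lying in $\mathbb C[\langle g\rangle]$, with $c_0\neq 0$, and let $$H_c=(\mathbb C\langle x,y\rangle\#\mathbb D_n)/(xy-yx-c),$$ where the skew group algebra has product $(P\otimes s)(Q\otimes t)=P\,s(Q)\otimes st$. A trace on $H_c$ is a linear map $T:H_c\to\mathbb C$ with $T(ab)=T(ba)$ for all $a,b\in H_c$. In $H_c$ put $$k=\frac1{c_0}\Big(xy+\sum_{i=1}^{n-1}\frac{c_ig^i}{\varepsilon^i-1}\Big)-\frac12,\qquad e_q=\frac1n\sum_{i=0}^{n-1}\varepsilon^{iq}g^i,\qquad \alpha_q=\frac1{c_0}\sum_{i=1}^{n-1}\frac{c_i\varepsilon^{-iq}}{\varepsilon^i-1}\in\mathbb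 C\qquad(q\in\mathbb Z).$$ Theorem. A linear map $T:H_c\to\mathbb C$ is a trace on $H_c$ if and only if all of the following conditions hold (for all $q\in\mathbb Z$, all $R\in\mathbb C[X]$ and all integers $i\ge 0$, subject to the stated restrictions): 1. $T(sas^{-1})=T(a)$ for all $s\in\mathbb D_n$ and $a\in H_c$; 2. $T(x^iR(k)e_q)=T(y^iR(k)e_q)=0$ when $i\neq0$; 3. $T(x^iR(k)e_qh)=T(y^iR(k)e_qh)=0$ when $2\nmid i$; 4. $T(x^{2i}R(k)e_qh)=T(S(k)R(k+i)e_{q-i}h)$, where $S\in\mathbb C[X]$ is the polynomial satisfying $x^iy^ie_{q-i}=S(k)e_{q-i}$; 5. $T(y^{2i}R(k)e_qh)=(-1)^iT(S(k)R(k-i)e_{q+i}h)$, where $S\in\mathbb C[X]$ is the polynomial satisfying $y^ix^ie_{q+i}=S(k)e_{q+i}$; 6. $T(k^ie_qh)=0$ when $i>0$; 7. $T\big((k+\tfrac12-\alpha_q)R(k+\tfrac12)e_q\big)=T\big((k-\tfrac12-\alpha_q)R(k-\tfrac12)e_{q+1}\big)$; 8. $T(R(k)e_q)=T(R(-k)e_{-q})$.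 -/

import Mathlib

open Polynomial

noncomputable section

namespace DicyclicCBH

/-- The root of unity `ε = exp(2πi/n)` with `n = 2m`. -/
def eps (m : ℕ) : ℂ := Complex.exp (2 * Real.pi * Complex.I / ((2 * m : ℕ) : ℂ))

/-- The dicyclic group `𝔻ₙ`, `n = 2m`, of order `2n = 4m`, with generators `g`, `h` and relations
`gⁿ = h⁴ = g h g h⁻¹ = 1`, `gᵐ = h²`.  In Mathlib's notation `a i = gⁱ` and `xa i = h gⁱ`. -/
abbrev Dic (m : ℕ) : Type := QuaternionGroup m

/-- The generator `g` of the dicyclic group. -/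
def gg (m : ℕ) : Dic m := QuaternionGroup.a 1

/-- The generator `h` of the dicyclic group. -/
def hh (m : ℕ) : Dic m := QuaternionGroup.xa 0

/-- The free associative algebra `ℂ⟨x, y⟩`, with `x = ι 0` and `y = ι 1`. -/
abbrev Free : Type := FreeAlgebra ℂ (Fin 2)

/-- The action of an element of the dicyclic group on the free algebra: `gⁱ` maps
`x ↦ εⁱ x`, `y ↦ ε⁻ⁱ y`, and `h gⁱ` maps `x ↦ εⁱ y`, `y ↦ - ε⁻ⁱ x`. -/
def act (m : ℕ) : Dic m → (Free →ₐ[ℂ] Free)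
  | QuaternionGroup.a i => FreeAlgebra.lift ℂ
      ![(eps m) ^ i.val • FreeAlgebra.ι ℂ 0, ((eps m) ^ i.val)⁻¹ • FreeAlgebra.ι ℂ 1]
  | QuaternionGroup.xa i => FreeAlgebra.lift ℂ
      ![(eps m) ^ i.val • FreeAlgebra.ι ℂ 1, -(((eps m) ^ i.val)⁻¹ • FreeAlgebra.ι ℂ 0)]

theorem eps_ne_zero (m : ℕ) : eps m ≠ 0 := Complex.exp_ne_zero _

theorem eps_pow_n (m : ℕ) [NeZero m] : eps m ^ (2 * m) = 1 := by
  have := Complex.isPrimitiveRoot_exp (2 * m) (NeZero.ne _)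
  exact this.pow_eq_one

theorem eps_pow_m (m : ℕ) [NeZero m] : eps m ^ m = -1 := by
  have h := Complex.isPrimitiveRoot_exp (2 * m) (NeZero.ne _)
  have h2 : IsPrimitiveRoot (eps m ^ m) 2 :=
    h.pow (Nat.pos_of_ne_zero (NeZero.ne _)) (mul_comm 2 m)
  exact h2.eq_neg_one_of_two_right

theorem eps_val_add (m : ℕ) [NeZero m] (i j : ZMod (2 * m)) :
    eps m ^ (i + j).val = eps m ^ i.val * eps m ^ j.val := by
  rw [ZMod.val_add, ← pow_add]
  exact (pow_eq_pow_mod _ (eps_pow_n m)).symm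

theorem eps_val_neg (m : ℕ) [NeZero m] (i : ZMod (2 * m)) :
    eps m ^ (-i).val = (eps m ^ i.val)⁻¹ := by
  have h : eps m ^ (-i).val * eps m ^ i.val = 1 := by
    rw [← eps_val_add]; simp
  exact eq_inv_of_mul_eq_one_left h

theorem eps_val_m (m : ℕ) [NeZero m] : eps m ^ ((m : ZMod (2 * m))).val = -1 := by
  rw [ZMod.val_natCast, ← pow_eq_pow_mod _ (eps_pow_n m), eps_pow_m]

theorem act_one (m : ℕ) [NeZero m] : act m 1 = AlgHom.id ℂ Free := by
  rw [QuaternionGroup.one_def]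
  ext i
  fin_cases i <;> simp [act]

theorem act_mul (m : ℕ) [NeZero m] (s t : Dic m) : act m (s * t) = (act m s).comp (act m t) := by
  rcases s with i | i <;> rcases t with j | j <;> ext k <;> fin_cases k <;>
    simp [act, sub_eq_add_neg, eps_val_add, eps_val_neg, eps_val_m, smul_smul, mul_comm,
      -ZMod.val_natCast, -Nat.cast_mul]

/-- The dicyclic group acts on `ℂ⟨x, y⟩` by algebra automorphisms. -/
instance instAction (m : ℕ) [NeZero m] : MulSemiringAction (Dic m) Free where
  smul s p := act m s p
  one_smul p := by change act m 1 p = p; rw [act_one]; rfl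
  mul_smul s t p := by change act m (s * t) p = act m s (act m t p); rw [act_mul]; rfl
  smul_zero s := map_zero (act m s)
  smul_add s := map_add (act m s)
  smul_one s := map_one (act m s)
  smul_mul s := map_mul (act m s)

instance instComm (m : ℕ) [NeZero m] : SMulCommClass (Dic m) ℂ Free where
  smul_comm s z p := map_smul (act m s) z p

/-- The skew group algebra `ℂ⟨x, y⟩ # 𝔻ₙ`, with product `(P ⊗ s)(Q ⊗ t) = P s(Q) ⊗ st`
(`SkewMonoidAlgebra.single s P` is `P ⊗ s`). -/
abbrev Skew (m : ℕ) [NeZero m] : Type := SkewMonoidAlgebra Free (Dic m)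

variable (m : ℕ) [NeZero m]

/-- The element of the skew group algebra given by an element of the group algebra `ℂ[𝔻ₙ]`. -/
def ofGroupAlgebra (c : MonoidAlgebra ℂ (Dic m)) : Skew m :=
  ∑ s : Dic m, SkewMonoidAlgebra.single s (algebraMap ℂ Free (c.coeff s))

/-- The relation `xy - yx = c`. -/
inductive Rel (c : MonoidAlgebra ℂ (Dic m)) : Skew m → Skew m → Prop
  | comm : Rel c
      (SkewMonoidAlgebra.single 1
        (FreeAlgebra.ι ℂ 0 * FreeAlgebra.ι ℂ 1 - FreeAlgebra.ι ℂ 1 * FreeAlgebra.ι ℂ 0))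
      (ofGroupAlgebra m c)

/-- The Crawley-Boevey–Holland algebra `H_c = (ℂ⟨x, y⟩ # 𝔻ₙ) / (xy - yx - c)`. -/
def H (c : MonoidAlgebra ℂ (Dic m)) : Type := RingQuot (Rel m c)

variable (c : MonoidAlgebra ℂ (Dic m))

instance instRingH : Ring (H m c) := inferInstanceAs (Ring (RingQuot (Rel m c)))

instance instAlgebraH : Algebra ℂ (H m c) := inferInstanceAs (Algebra ℂ (RingQuot (Rel m c)))

/-- The quotient map onto `H_c`. -/
def mkH : Skew m →ₐ[ℂ] H m c := RingQuot.mkAlgHom ℂ (Rel m c)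

/-- The generator `x` of `H_c`. -/
def xH : H m c := mkH m c (SkewMonoidAlgebra.single 1 (FreeAlgebra.ι ℂ 0))

/-- The generator `y` of `H_c`. -/
def yH : H m c := mkH m c (SkewMonoidAlgebra.single 1 (FreeAlgebra.ι ℂ 1))

/-- The image in `H_c` of an element of the dicyclic group. -/
def grp (s : Dic m) : H m c := mkH m c (SkewMonoidAlgebra.single s 1)

/-- The coefficient `c_i` of `gⁱ` in `c`. -/
def coef (i : ℕ) : ℂ := c.coeff (gg m ^ i)

/-- `k = (1/c₀) (xy + ∑_{i=1}^{n-1} c_i gⁱ / (εⁱ - 1)) - 1/2`. -/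
def K : H m c :=
  (coef m c 0)⁻¹ • (xH m c * yH m c +
    ∑ i ∈ Finset.Icc 1 (2 * m - 1), (coef m c i / (eps m ^ i - 1)) • grp m c (gg m ^ i))
  - algebraMap ℂ (H m c) (1 / 2)

/-- `e_q = (1/n) ∑_{i=0}^{n-1} ε^{iq} gⁱ`. -/
def E (q : ℤ) : H m c :=
  ((2 * m : ℕ) : ℂ)⁻¹ •
    ∑ i ∈ Finset.range (2 * m), (eps m ^ ((i : ℤ) * q)) • grp m c (gg m ^ i)

/-- `α_q = (1/c₀) ∑_{i=1}^{n-1} c_i ε^{-iq} / (εⁱ - 1)`. -/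
def alpha (q : ℤ) : ℂ :=
  (coef m c 0)⁻¹ *
    ∑ i ∈ Finset.Icc 1 (2 * m - 1), coef m c i * eps m ^ (-((i : ℤ) * q)) / (eps m ^ i - 1)

/-- For a polynomial `R` and a scalar `t ∈ ℂ`, the element `R(k + t)` of `H_c`. -/
def polyK (R : ℂ[X]) (t : ℂ) : H m c := aeval (K m c + algebraMap ℂ (H m c) t) R

/-- A trace on `H_c`: a linear map with `T(ab) = T(ba)`. -/
def IsTrace (T : H m c →ₗ[ℂ] ℂ) : Prop := ∀ a b : H m c, T (a * b) = T (b * a)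

end DicyclicCBH

end

open DicyclicCBH

/-!
Write `P_q = c₀ (X + 1/2 - α_q)`. A direct computation gives the relations `x k = (k + 1) x`,
`y k = (k - 1) y`, `h k = -k h` (`x_mul_K`, `y_mul_K`, `h_mul_K`), `x e_q = e_{q-1} x`,
`y e_q = e_{q+1} y`, `h e_q = e_{-q} h`, and `x y e_q = P_q(k) e_q`, `y x e_q = P_{q-1}(k - 1) e_q`
(`x_mul_y_mul_E`, `y_mul_x_mul_E`). In particular `H_c` is spanned by the elements `uⁱ R(k) e_q s`
with `u ∈ {x, y}` and `s ∈ {1, h}` (`span_normalForms_eq_top`). Linear independence of these is not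
used anywhere.

A trace satisfies the conditions because each of them compares `T(ab)` with `T(ba)`: the vanishing
conditions come from commutators with `k` and from conjugation by `gᵐ = h²`, the reduction of
`x²ⁱ` and `y²ⁱ` from moving the factor `xⁱ` or `yⁱ` around cyclically, and the shift condition from
`x · y R(k) e_q`.

Conversely, the elements `a` with `T(ab) = T(ba)` for all `b` form a subalgebra, which contains the
group by conjugation invariance. Since `y = h x h⁻¹`, it is enough to treat `a = x`
(`isTrace_of_x_mul`), and `b` may be taken from the spanning set. For `b` without the factor `h` only
`b = y R(k) e_q` is not trivially fine, and that is the shift condition. For `b = xⁱ R(k) e_q h` with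
`i` odd both sides reduce to the same value on `ℂ[k] e_r h`. For `b = y²ʲ⁺¹ R(k) e_q h`, with
`r = q + j`, the condition on `kⁱ e_q h` turns the difference of the two sides into a multiple of
`(α_{r+j} + α_{r-j-1}) T(e_r h)`. This vanishes (`alpha_add_alpha_mul_map_E_mul_h`): conjugation by
`g` shows that `T(e_r h) = 0` unless `ε^{2r} = 1`, and then `α_{r-j-1} = α_{-r-j-1} = -α_{r+j}`,
by the symmetry `c_{-i} = c_i` of the central element `c`.
-/

namespace DicyclicCBH

open QuaternionGroup

/-! ### The cyclic subgroup and sums over it -/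

/-- The character `gⁱ ↦ εⁱ` of the cyclic subgroup `⟨g⟩`, as a function of `i ∈ ℤ/n`. -/
noncomputable def chi (m : ℕ) (i : ZMod (2 * m)) : ℂ := eps m ^ i.val

section Scalars

variable {m : ℕ}

theorem chi_ne_zero (i : ZMod (2 * m)) : chi m i ≠ 0 := pow_ne_zero _ (eps_ne_zero m)

theorem chi_zero : chi m 0 = 1 := by simp [chi]

theorem gg_pow (i : ℕ) : gg m ^ i = a (i : ZMod (2 * m)) := a_one_pow i

theorem coef_zero (c : MonoidAlgebra ℂ (Dic m)) : coef m c 0 = c.coeff 1 := by simp [coef]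

/-- A central element of the group algebra has equal coefficients at `gⁱ` and at
`h gⁱ h⁻¹ = g⁻ⁱ`. -/
theorem coeff_neg_of_mem_center {c : MonoidAlgebra ℂ (Dic m)}
    (hcenter : c ∈ Subalgebra.center ℂ (MonoidAlgebra ℂ (Dic m))) (i : ZMod (2 * m)) :
    c.coeff (a (-i)) = c.coeff (a i) := by
  have h := Subalgebra.mem_center_iff.1 hcenter (MonoidAlgebra.single (hh m) 1)
  have h1 := congrArg (fun d => d.coeff (xa i)) h
  rw [MonoidAlgebra.coeff_single_mul_eq_mul_coeff (a i),
    MonoidAlgebra.coeff_mul_single_eq_coeff_mul (a (-i))] at h1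
  · simpa using h1.symm
  · intro s _
    rw [← eq_mul_inv_iff_mul_eq]
    have : a (-i) * hh m = xa i := by simp [hh]
    rw [← this, mul_inv_cancel_right]
  · intro s _
    rw [← eq_inv_mul_iff_mul_eq]
    have : hh m * a i = xa i := by simp [hh]
    rw [← this, inv_mul_cancel_left]

variable [NeZero m]

theorem chi_add (i j : ZMod (2 * m)) : chi m (i + j) = chi m i * chi m j := eps_val_add m i j

theorem chi_neg (i : ZMod (2 * m)) : chi m (-i) = (chi m i)⁻¹ := eps_val_neg m i

theorem chi_natCast (i : ℕ) : chi m (i : ZMod (2 * m)) = eps m ^ i := by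
  rw [chi, ZMod.val_natCast, ← pow_eq_pow_mod _ (eps_pow_n m)]

theorem chi_one : chi m 1 = eps m := by
  simpa using chi_natCast (m := m) 1

theorem chi_half : chi m (m : ZMod (2 * m)) = -1 := eps_val_m m

theorem chi_ne_one {i : ZMod (2 * m)} (hi : i ≠ 0) : chi m i ≠ 1 := by
  have h := Complex.isPrimitiveRoot_exp (2 * m) (NeZero.ne _)
  exact h.pow_ne_one_of_pos_of_lt (by simpa using hi) (ZMod.val_lt i)

theorem sum_range_eq_sum_zmod {M : Type*} [AddCommMonoid M] (f : ZMod (2 * m) → M) :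
    ∑ i ∈ Finset.range (2 * m), f (i : ZMod (2 * m)) = ∑ i, f i := by
  refine Finset.sum_bij' (fun i _ => (i : ZMod (2 * m))) (fun i _ => i.val) ?_ ?_ ?_ ?_ ?_
  · simp
  · intro i _
    exact Finset.mem_range.2 (ZMod.val_lt i)
  · intro i hi
    exact ZMod.val_cast_of_lt (Finset.mem_range.1 hi)
  · simp
  · simp

theorem sum_Icc_eq_sum_zmod {M : Type*} [AddCommMonoid M] (f : ZMod (2 * m) → M) (h0 : f 0 = 0) :
    ∑ i ∈ Finset.Icc 1 (2 * m - 1), f (i : ZMod (2 * m)) = ∑ i, f i := by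
  have hn : 2 * m = (2 * m - 1) + 1 := by have := NeZero.pos m; omega
  have hI : Finset.range (2 * m) = insert 0 (Finset.Icc 1 (2 * m - 1)) := by
    ext i
    simp only [Finset.mem_range, Finset.mem_insert, Finset.mem_Icc]
    omega
  rw [← sum_range_eq_sum_zmod f, hI, Finset.sum_insert (by simp), Nat.cast_zero, h0, zero_add]

theorem not_mem_zpowers_xa (i : ZMod (2 * m)) : xa i ∉ Subgroup.zpowers (gg m) := by
  rw [← mem_powers_iff_mem_zpowers]
  rintro ⟨k, hk⟩
  simp [gg_pow] at hk

end Scalars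

section Relations

variable (m : ℕ) [NeZero m] (c : MonoidAlgebra ℂ (Dic m))

/-! ### Generators and relations of `H_c` -/

theorem grp_one : grp m c 1 = 1 := map_one (mkH m c)

theorem grp_mul (s t : Dic m) : grp m c (s * t) = grp m c s * grp m c t := by
  rw [grp, grp, grp, ← map_mul, SkewMonoidAlgebra.single_mul_single, smul_one, mul_one]

theorem mkH_single (s : Dic m) (P : Free) :
    mkH m c (SkewMonoidAlgebra.single s P) =
      mkH m c (SkewMonoidAlgebra.single 1 P) * grp m c s := by
  rw [grp, ← map_mul, SkewMonoidAlgebra.single_mul_single, one_mul, smul_one, mul_one]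

theorem grp_mul_mkH (s : Dic m) (P : Free) :
    grp m c s * mkH m c (SkewMonoidAlgebra.single 1 P) =
      mkH m c (SkewMonoidAlgebra.single 1 (act m s P)) * grp m c s := by
  rw [← mkH_single, grp, ← map_mul, SkewMonoidAlgebra.single_mul_single, one_mul, mul_one]
  rfl

theorem mkH_single_smul (z : ℂ) (s : Dic m) (P : Free) :
    mkH m c (SkewMonoidAlgebra.single s (z • P)) =
      z • mkH m c (SkewMonoidAlgebra.single s P) := by
  rw [← map_smul, SkewMonoidAlgebra.smul_single]

theorem mkH_single_algebraMap (z : ℂ) :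
    mkH m c (SkewMonoidAlgebra.single 1 (algebraMap ℂ Free z)) = algebraMap ℂ (H m c) z := by
  rw [Algebra.algebraMap_eq_smul_one, mkH_single_smul, Algebra.algebraMap_eq_smul_one]
  congr 1
  exact map_one (mkH m c)

theorem grp_a_mul_x (i : ZMod (2 * m)) :
    grp m c (a i) * xH m c = chi m i • (xH m c * grp m c (a i)) := by
  rw [xH, grp_mul_mkH, ← smul_mul_assoc, ← mkH_single_smul]
  simp [act, chi]

theorem grp_a_mul_y (i : ZMod (2 * m)) :
    grp m c (a i) * yH m c = (chi m i)⁻¹ • (yH m c * grp m c (a i)) := by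
  rw [yH, grp_mul_mkH, ← smul_mul_assoc, ← mkH_single_smul]
  simp [act, chi]

theorem h_mul_x : grp m c (hh m) * xH m c = yH m c * grp m c (hh m) := by
  rw [xH, yH, grp_mul_mkH]
  simp [act, hh]

theorem h_mul_y : grp m c (hh m) * yH m c = -(xH m c * grp m c (hh m)) := by
  rw [xH, yH, grp_mul_mkH, ← neg_mul, ← neg_one_smul ℂ (mkH m c _), ← mkH_single_smul]
  simp [act, hh]

theorem h_mul_grp_a (i : ZMod (2 * m)) :
    grp m c (hh m) * grp m c (a i) = grp m c (a (-i)) * grp m c (hh m) := by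
  rw [← grp_mul, ← grp_mul]
  simp [hh]

theorem h_mul_h : grp m c (hh m) * grp m c (hh m) = grp m c (a (m : ZMod (2 * m))) := by
  rw [← grp_mul]
  simp [hh]

theorem grp_xa (i : ZMod (2 * m)) :
    grp m c (xa i) = grp m c (hh m) * grp m c (a i) := by
  rw [← grp_mul]
  simp [hh]

theorem grp_mul_grp_inv (s : Dic m) : grp m c s * grp m c s⁻¹ = 1 := by
  rw [← grp_mul, mul_inv_cancel, grp_one]

theorem grp_inv_mul_grp (s : Dic m) : grp m c s⁻¹ * grp m c s = 1 := by
  rw [← grp_mul, inv_mul_cancel, grp_one]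

/-- Since `y = h x h⁻¹`, the algebra `H_c` is generated by `x` and the group. -/
theorem subalgebra_eq_top (A : Subalgebra ℂ (H m c)) (hx : xH m c ∈ A)
    (hgrp : ∀ s, grp m c s ∈ A) : A = ⊤ := by
  have hy : yH m c ∈ A := by
    have : yH m c = grp m c (hh m) * xH m c * grp m c (hh m)⁻¹ := by
      rw [h_mul_x, mul_assoc, grp_mul_grp_inv, mul_one]
    rw [this]
    exact A.mul_mem (A.mul_mem (hgrp _) hx) (hgrp _)
  have hP : ∀ P : Free, mkH m c (SkewMonoidAlgebra.single 1 P) ∈ A := by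
    intro P
    induction P using FreeAlgebra.induction with
    | grade0 r => rw [mkH_single_algebraMap]; exact A.algebraMap_mem r
    | grade1 i => fin_cases i <;> assumption
    | mul P Q hP hQ =>
      have : SkewMonoidAlgebra.single (1 : Dic m) (P * Q) =
          SkewMonoidAlgebra.single 1 P * SkewMonoidAlgebra.single 1 Q := by
        rw [SkewMonoidAlgebra.single_mul_single, one_mul, one_smul]
      rw [this, map_mul]
      exact A.mul_mem hP hQ
    | add P Q hP hQ =>
      rw [SkewMonoidAlgebra.single_add, map_add]
      exact A.add_mem hP hQ
  rw [eq_top_iff]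
  rintro b -
  obtain ⟨p, rfl⟩ : ∃ p, mkH m c p = b := RingQuot.mkAlgHom_surjective ℂ (Rel m c) b
  induction p using SkewMonoidAlgebra.induction_on with
  | zero => rw [map_zero]; exact A.zero_mem
  | single s P => rw [mkH_single]; exact A.mul_mem (hP P) (hgrp s)
  | add p q hp hq => rw [map_add]; exact A.add_mem hp hq

variable {c} in
/-- The defining relation, with `c` written as a sum over the cyclic subgroup supporting it. -/
theorem x_mul_y_eq (hcyclic : ∀ s : Dic m, s ∉ Subgroup.zpowers (gg m) → c.coeff s = 0) :
    xH m c * yH m c = yH m c * xH m c + ∑ i, c.coeff (a i) • grp m c (a i) := by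
  have h1 : ∀ P Q : Free, mkH m c (SkewMonoidAlgebra.single 1 (P * Q)) =
      mkH m c (SkewMonoidAlgebra.single 1 P) * mkH m c (SkewMonoidAlgebra.single 1 Q) := by
    intro P Q
    rw [← map_mul, SkewMonoidAlgebra.single_mul_single, one_mul, one_smul]
  have h2 := RingQuot.mkAlgHom_rel ℂ (Rel.comm (m := m) (c := c))
  change mkH m c _ = mkH m c _ at h2
  rw [sub_eq_add_neg, SkewMonoidAlgebra.single_add, SkewMonoidAlgebra.single_neg, map_add, map_neg,
    h1, h1, ofGroupAlgebra, map_sum] at h2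
  rw [add_comm, ← sub_eq_iff_eq_add, sub_eq_add_neg]
  refine h2.trans ?_
  have h3 : ∀ s : Dic m, mkH m c (SkewMonoidAlgebra.single s (algebraMap ℂ Free (c.coeff s))) =
      c.coeff s • grp m c s := by
    intro s
    rw [Algebra.algebraMap_eq_smul_one, mkH_single_smul, grp]
  simp only [h3]
  symm
  refine Finset.sum_of_injOn (fun i => (a i : Dic m)) ?_ (by simp) ?_ (by simp)
  · intro i _ j _ hij
    simpa using hij
  · rintro (i | i) _ hs
    · simp at hs
    · rw [hcyclic _ (not_mem_zpowers_xa i), zero_smul]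

/-! ### The idempotents `e_q` -/

theorem E_eq_sum (q : ℤ) :
    E m c q = ((2 * m : ℕ) : ℂ)⁻¹ • ∑ i : ZMod (2 * m), chi m i ^ q • grp m c (a i) := by
  rw [E, ← sum_range_eq_sum_zmod]
  simp only [chi_natCast, gg_pow, zpow_mul, zpow_natCast]

theorem grp_a_mul_E (j : ZMod (2 * m)) (q : ℤ) :
    grp m c (a j) * E m c q = chi m j ^ (-q) • E m c q := by
  rw [E_eq_sum, mul_smul_comm, smul_comm, Finset.mul_sum, Finset.smul_sum (r := chi m j ^ (-q))]
  congr 1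
  refine Fintype.sum_equiv (Equiv.addLeft j) _ _ fun i => ?_
  rw [Equiv.coe_addLeft, mul_smul_comm, ← grp_mul, a_mul_a, smul_smul, chi_add, mul_zpow,
    ← mul_assoc, ← zpow_add₀ (chi_ne_zero j), neg_add_cancel, zpow_zero, one_mul]

theorem E_mul_grp_a (j : ZMod (2 * m)) (q : ℤ) :
    E m c q * grp m c (a j) = chi m j ^ (-q) • E m c q := by
  rw [← grp_a_mul_E, E_eq_sum, smul_mul_assoc, mul_smul_comm, Finset.sum_mul, Finset.mul_sum]
  simp only [smul_mul_assoc, mul_smul_comm, ← grp_mul, a_mul_a, add_comm j]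

theorem x_mul_E (q : ℤ) : xH m c * E m c q = E m c (q - 1) * xH m c := by
  rw [E_eq_sum, E_eq_sum, mul_smul_comm, smul_mul_assoc, Finset.mul_sum, Finset.sum_mul]
  congr 1
  refine Finset.sum_congr rfl fun i _ => ?_
  rw [mul_smul_comm, smul_mul_assoc, grp_a_mul_x, smul_smul, ← zpow_add_one₀ (chi_ne_zero i),
    sub_add_cancel]

theorem y_mul_E (q : ℤ) : yH m c * E m c q = E m c (q + 1) * yH m c := by
  rw [E_eq_sum, E_eq_sum, mul_smul_comm, smul_mul_assoc, Finset.mul_sum, Finset.sum_mul]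
  congr 1
  refine Finset.sum_congr rfl fun i _ => ?_
  rw [mul_smul_comm, smul_mul_assoc, grp_a_mul_y, smul_smul, zpow_add_one₀ (chi_ne_zero i),
    mul_inv_cancel_right₀ (chi_ne_zero i)]

theorem h_mul_E (q : ℤ) : grp m c (hh m) * E m c q = E m c (-q) * grp m c (hh m) := by
  rw [E_eq_sum, E_eq_sum, mul_smul_comm, smul_mul_assoc, Finset.mul_sum, Finset.sum_mul]
  congr 1
  refine Fintype.sum_equiv (Equiv.neg _) _ _ fun i => ?_
  rw [mul_smul_comm, smul_mul_assoc, h_mul_grp_a, Equiv.neg_apply, chi_neg, inv_zpow', neg_neg]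

theorem sum_E : ∑ q ∈ Finset.range (2 * m), E m c q = 1 := by
  have hn : ((2 * m : ℕ) : ℂ) ≠ 0 := Nat.cast_ne_zero.2 (NeZero.ne _)
  simp only [E_eq_sum]
  rw [← Finset.smul_sum, Finset.sum_comm, Finset.sum_eq_single 0]
  · simp only [chi_zero, one_zpow, one_smul, Finset.sum_const, Finset.card_range, a_zero, grp_one]
    rw [← Nat.cast_smul_eq_nsmul ℂ, smul_smul, inv_mul_cancel₀ hn, one_smul]
  · intro i _ hi
    rw [← Finset.sum_smul]
    simp only [zpow_natCast]
    rw [geom_sum_eq (chi_ne_one hi), chi, ← pow_mul, mul_comm i.val, pow_mul, eps_pow_n, one_pow,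
      sub_self, zero_div, zero_smul]
  · simp

/-! ### The element `k` -/

/-- The sum defining `k` may be extended to all of `ℤ/n`: the term at `i = 0` is a division by
zero, hence contributes `0`. -/
theorem K_eq_sum :
    K m c = (coef m c 0)⁻¹ • (xH m c * yH m c +
      ∑ i : ZMod (2 * m), (c.coeff (a i) / (chi m i - 1)) • grp m c (a i)) -
        algebraMap ℂ (H m c) (1 / 2) := by
  rw [K, ← sum_Icc_eq_sum_zmod _ (by simp [chi_zero])]
  simp only [chi_natCast, gg_pow, coef]

theorem alpha_eq_sum (q : ℤ) :
    alpha m c q = (coef m c 0)⁻¹ *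
      ∑ i : ZMod (2 * m), c.coeff (a i) * chi m i ^ (-q) / (chi m i - 1) := by
  rw [alpha, ← sum_Icc_eq_sum_zmod _ (by simp [chi_zero])]
  simp only [chi_natCast, gg_pow, coef, ← mul_neg, zpow_mul, zpow_natCast]

theorem grp_a_mul_xy (i : ZMod (2 * m)) :
    grp m c (a i) * (xH m c * yH m c) = xH m c * yH m c * grp m c (a i) := by
  rw [← mul_assoc, grp_a_mul_x, smul_mul_assoc, mul_assoc, grp_a_mul_y, mul_smul_comm, smul_smul,
    mul_inv_cancel₀ (chi_ne_zero i), one_smul, mul_assoc]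

theorem commute_grp_a_K (i : ZMod (2 * m)) : Commute (grp m c (a i)) (K m c) := by
  rw [K_eq_sum]
  refine ((Commute.add_right (grp_a_mul_xy m c i) ?_).smul_right _).sub_right
    (Algebra.commute_algebraMap_right _ _)
  refine Commute.sum_right _ _ _ fun j _ => Commute.smul_right ?_ _
  rw [commute_iff_eq, ← grp_mul, ← grp_mul, a_mul_a, a_mul_a, add_comm]

theorem commute_E_K (q : ℤ) : Commute (E m c q) (K m c) := by
  rw [E_eq_sum]
  exact (Commute.sum_left _ _ _ fun i _ => (commute_grp_a_K m c i).smul_left _).smul_left _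

/-- Splitting off the term at `i = 0` in a sum over the cyclic group weighted by `c`. -/
theorem sum_coeff_split (f : ZMod (2 * m) → ℂ) (h0 : f 0 = 0) (h1 : ∀ i ≠ 0, f i = 1) :
    ∑ i : ZMod (2 * m), (c.coeff (a i) * f i) • grp m c (a i) =
      ∑ i, c.coeff (a i) • grp m c (a i) - algebraMap ℂ (H m c) (coef m c 0) := by
  rw [eq_sub_iff_add_eq, ← Finset.sum_erase_add Finset.univ (fun i => (c.coeff (a i) * f i) • grp m c (a i))
      (Finset.mem_univ (0 : ZMod (2 * m))),
    ← Finset.sum_erase_add Finset.univ (fun i => c.coeff (a i) • grp m c (a i))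
      (Finset.mem_univ (0 : ZMod (2 * m))), h0, mul_zero, zero_smul, add_zero, coef_zero, a_zero,
    grp_one, Algebra.algebraMap_eq_smul_one]
  congr 1
  refine Finset.sum_congr rfl fun i hi => ?_
  rw [h1 i (Finset.ne_of_mem_erase hi), mul_one]

end Relations

/-- The standing hypotheses on the parameter `c`: it is central in `ℂ[𝔻ₙ]`, supported on the cyclic
subgroup `⟨g⟩`, and its coefficient at `1` is nonzero. -/
structure IsAdmissible (m : ℕ) (c : MonoidAlgebra ℂ (Dic m)) : Prop where
  mem_center : c ∈ Subalgebra.center ℂ (MonoidAlgebra ℂ (Dic m))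
  coeff_eq_zero : ∀ s : Dic m, s ∉ Subgroup.zpowers (gg m) → c.coeff s = 0
  coeff_one_ne_zero : c.coeff 1 ≠ 0

section Admissible

variable {m : ℕ} [NeZero m] {c : MonoidAlgebra ℂ (Dic m)}

/-- Moving `x` past the correction terms `c_i gⁱ / (εⁱ - 1)` of `k` produces exactly the terms of
`c = xy - yx` with `i ≠ 0`, so only `c₀` survives in the commutator. -/
theorem x_mul_K (hc : IsAdmissible m c) : xH m c * K m c = (K m c + 1) * xH m c := by
  have hc0 : coef m c 0 ≠ 0 := by rw [coef_zero]; exact hc.coeff_one_ne_zero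
  rw [K_eq_sum]
  set s : H m c := ∑ i : ZMod (2 * m), (c.coeff (a i) / (chi m i - 1)) • grp m c (a i) with hs
  have hsx : s * xH m c = xH m c * (s + ∑ i : ZMod (2 * m), c.coeff (a i) • grp m c (a i) -
      algebraMap ℂ (H m c) (coef m c 0)) := by
    rw [add_sub_assoc, ← sum_coeff_split m c (fun i => (chi m i - 1) / (chi m i - 1))
      (by simp [chi_zero]) (fun i hi => div_self (sub_ne_zero.2 (chi_ne_one hi))), hs,
      ← Finset.sum_add_distrib, Finset.sum_mul, Finset.mul_sum]
    refine Finset.sum_congr rfl fun i _ => ?_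
    rw [smul_mul_assoc, grp_a_mul_x, smul_smul, ← add_smul, mul_smul_comm]
    congr 1
    by_cases hi : i = 0
    · simp [hi, chi_zero]
    · have := sub_ne_zero.2 (chi_ne_one hi)
      field_simp
      ring
  have hxy := x_mul_y_eq m hc.coeff_eq_zero
  set t : H m c := ∑ i : ZMod (2 * m), c.coeff (a i) • grp m c (a i)
  have h3 : (xH m c * yH m c + s) * xH m c =
      xH m c * (xH m c * yH m c + s) - coef m c 0 • xH m c := by
    rw [add_mul, hsx, mul_assoc, eq_sub_of_add_eq hxy.symm, mul_sub, mul_sub, mul_add,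
      mul_add,
      ← Algebra.commutes, ← Algebra.smul_def]
    abel
  rw [mul_sub, mul_smul_comm, add_mul, sub_mul, smul_mul_assoc, h3, smul_sub, smul_smul,
    inv_mul_cancel₀ hc0, one_smul, one_mul, Algebra.commutes]
  abel

/-- Conjugation by `h` negates `k`; this is where the symmetry `c_{-i} = c_i` enters. -/
theorem h_mul_K (hc : IsAdmissible m c) : grp m c (hh m) * K m c = -K m c * grp m c (hh m) := by
  have hc0 : coef m c 0 ≠ 0 := by rw [coef_zero]; exact hc.coeff_one_ne_zero
  rw [K_eq_sum]
  set s : H m c := ∑ i : ZMod (2 * m), (c.coeff (a i) / (chi m i - 1)) • grp m c (a i) with hs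
  have hsh : grp m c (hh m) * s = (algebraMap ℂ (H m c) (coef m c 0) -
      ∑ i : ZMod (2 * m), c.coeff (a i) • grp m c (a i) - s) * grp m c (hh m) := by
    rw [← neg_sub _ (algebraMap ℂ (H m c) (coef m c 0)),
      ← sum_coeff_split m c (fun i => (chi m i - 1) / (chi m i - 1))
      (by simp [chi_zero]) (fun i hi => div_self (sub_ne_zero.2 (chi_ne_one hi))), hs,
      ← neg_add', ← Finset.sum_add_distrib, ← Finset.sum_neg_distrib, Finset.sum_mul,
      Finset.mul_sum]
    refine Fintype.sum_equiv (Equiv.neg _) _ _ fun i => ?_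
    rw [mul_smul_comm, h_mul_grp_a, Equiv.neg_apply, coeff_neg_of_mem_center hc.mem_center, ← add_smul,
      ← neg_smul, smul_mul_assoc, chi_neg]
    congr 1
    by_cases hi : i = 0
    · simp [hi, chi_zero]
    · have h1 := sub_ne_zero.2 (chi_ne_one hi)
      have h2 : (1 : ℂ) - chi m i ≠ 0 := sub_ne_zero.2 (chi_ne_one hi).symm
      have h3 := chi_ne_zero i
      have h4 : (chi m i)⁻¹ - 1 ≠ 0 := by
        rw [← chi_neg]
        exact sub_ne_zero.2 (chi_ne_one (neg_ne_zero.2 hi))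
      rw [div_self h4]
      field_simp
      ring
  have hxy := x_mul_y_eq m hc.coeff_eq_zero
  set t : H m c := ∑ i : ZMod (2 * m), c.coeff (a i) • grp m c (a i)
  have h3 : grp m c (hh m) * (xH m c * yH m c + s) =
      (algebraMap ℂ (H m c) (coef m c 0) - (xH m c * yH m c + s)) * grp m c (hh m) := by
    rw [mul_add, hsh, ← mul_assoc, h_mul_x, mul_assoc, h_mul_y, mul_neg, ← mul_assoc, ← neg_mul,
      ← add_mul, eq_sub_of_add_eq hxy.symm]
    congr 1
    abel
  rw [mul_sub, mul_smul_comm, h3, ← smul_mul_assoc, smul_sub, ← Algebra.commutes, ← sub_mul]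
  congr 1
  rw [Algebra.smul_def _ (algebraMap ℂ (H m c) (coef m c 0)), ← map_mul, inv_mul_cancel₀ hc0]
  rw [show algebraMap ℂ (H m c) 1 = algebraMap ℂ (H m c) (1 / 2) + algebraMap ℂ (H m c) (1 / 2) by
    rw [← map_add]; norm_num]
  abel

/-- The conjugate by `h` of the relation between `x` and `k`. -/
theorem y_mul_K (hc : IsAdmissible m c) : yH m c * K m c = (K m c - 1) * yH m c := by
  have h : yH m c * K m c * grp m c (hh m) = (K m c - 1) * yH m c * grp m c (hh m) := by
    have hK : K m c * grp m c (hh m) = -(grp m c (hh m) * K m c) := by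
      rw [h_mul_K hc, neg_mul, neg_neg]
    rw [mul_assoc, hK, mul_neg, ← mul_assoc, ← h_mul_x, mul_assoc, x_mul_K hc, ← mul_assoc, mul_add,
      h_mul_K hc, mul_one, add_mul, mul_assoc (-K m c), h_mul_x, sub_mul, one_mul, sub_mul, neg_mul,
      ← mul_assoc]
    abel
  simpa only [mul_assoc, grp_mul_grp_inv, mul_one] using congrArg (· * grp m c (hh m)⁻¹) h

/-! ### Commutation rules for polynomials in `k` -/

theorem aeval_add_algebraMap {A : Type*} [Ring A] [Algebra ℂ A] (k : A) (R : ℂ[X]) (t : ℂ) :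
    aeval (k + algebraMap ℂ A t) R = aeval k (taylor t R) := by
  simp [taylor_apply, aeval_comp]

theorem polyK_eq (R : ℂ[X]) (t : ℂ) : polyK m c R t = aeval (K m c) (taylor t R) :=
  aeval_add_algebraMap _ _ _

theorem _root_.SemiconjBy.aeval {A : Type*} [Ring A] [Algebra ℂ A] {u k k' : A}
    (h : SemiconjBy u k k') (R : ℂ[X]) : SemiconjBy u (aeval k R) (aeval k' R) := by
  induction R using Polynomial.induction_on' with
  | add p q hp hq => simpa using hp.add_right hq
  | monomial n z =>
    rw [aeval_monomial, aeval_monomial]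
    exact SemiconjBy.mul_right (Algebra.commute_algebraMap_right z u) (h.pow_right n)

theorem aeval_K_mul_x_pow (hc : IsAdmissible m c) (R : ℂ[X]) (i : ℕ) :
    aeval (K m c) R * xH m c ^ i = xH m c ^ i * aeval (K m c) (taylor (-(i : ℂ)) R) := by
  have h : SemiconjBy (xH m c ^ i) (K m c + algebraMap ℂ (H m c) (-(i : ℂ))) (K m c) := by
    induction i with
    | zero => simp
    | succ i ih =>
      have h1 : SemiconjBy (xH m c) (K m c + algebraMap ℂ (H m c) (-1)) (K m c) := by
        simp [SemiconjBy, mul_add, x_mul_K hc, add_mul]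
      have h2 := h1.add_right (Algebra.commute_algebraMap_right (-(i : ℂ)) (xH m c))
      have h3 : K m c + algebraMap ℂ (H m c) (-((i + 1 : ℕ) : ℂ)) =
          K m c + algebraMap ℂ (H m c) (-1) + algebraMap ℂ (H m c) (-(i : ℂ)) := by
        rw [add_assoc, ← map_add, Nat.cast_succ, neg_add_rev]
      rw [pow_succ, h3]
      exact ih.mul_left h2
  rw [← aeval_add_algebraMap]
  exact (h.aeval R).symm

theorem aeval_K_mul_y_pow (hc : IsAdmissible m c) (R : ℂ[X]) (i : ℕ) :
    aeval (K m c) R * yH m c ^ i = yH m c ^ i * aeval (K m c) (taylor (i : ℂ) R) := by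
  have h : SemiconjBy (yH m c ^ i) (K m c + algebraMap ℂ (H m c) (i : ℂ)) (K m c) := by
    induction i with
    | zero => simp
    | succ i ih =>
      have h1 : SemiconjBy (yH m c) (K m c + algebraMap ℂ (H m c) 1) (K m c) := by
        simp [SemiconjBy, mul_add, y_mul_K hc, sub_mul]
      have h2 := h1.add_right (Algebra.commute_algebraMap_right (i : ℂ) (yH m c))
      have h3 : K m c + algebraMap ℂ (H m c) ((i + 1 : ℕ) : ℂ) =
          K m c + algebraMap ℂ (H m c) 1 + algebraMap ℂ (H m c) (i : ℂ) := by
        rw [add_assoc, ← map_add, Nat.cast_succ, add_comm (1 : ℂ)]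
      rw [pow_succ, h3]
      exact ih.mul_left h2
  rw [← aeval_add_algebraMap]
  exact (h.aeval R).symm

theorem h_mul_aeval_K (hc : IsAdmissible m c) (R : ℂ[X]) :
    grp m c (hh m) * aeval (K m c) R = aeval (-K m c) R * grp m c (hh m) :=
  SemiconjBy.aeval (h_mul_K hc) R

theorem aeval_neg_K (R : ℂ[X]) : aeval (-K m c) R = aeval (K m c) (R.comp (-X)) := by
  simp [aeval_comp]

theorem grp_a_mul_aeval_K (i : ZMod (2 * m)) (R : ℂ[X]) :
    grp m c (a i) * aeval (K m c) R = aeval (K m c) R * grp m c (a i) :=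
  SemiconjBy.aeval (commute_grp_a_K m c i) R

theorem E_mul_aeval_K (q : ℤ) (R : ℂ[X]) :
    E m c q * aeval (K m c) R = aeval (K m c) R * E m c q :=
  SemiconjBy.aeval (commute_E_K m c q) R

theorem E_mul_x_pow (q : ℤ) (i : ℕ) :
    E m c q * xH m c ^ i = xH m c ^ i * E m c (q + i) := by
  induction i with
  | zero => simp
  | succ i ih =>
    rw [pow_succ, ← mul_assoc, ih, mul_assoc, mul_assoc, x_mul_E]
    congr 3
    push_cast
    ring

theorem E_mul_y_pow (q : ℤ) (i : ℕ) :
    E m c q * yH m c ^ i = yH m c ^ i * E m c (q - i) := by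
  induction i with
  | zero => simp
  | succ i ih =>
    rw [pow_succ, ← mul_assoc, ih, mul_assoc, mul_assoc, y_mul_E]
    congr 3
    push_cast
    ring

theorem h_mul_x_pow (i : ℕ) :
    grp m c (hh m) * xH m c ^ i = yH m c ^ i * grp m c (hh m) :=
  SemiconjBy.pow_right (h_mul_x m c) i

theorem h_mul_y_pow (i : ℕ) :
    grp m c (hh m) * yH m c ^ i = (-1 : ℂ) ^ i • (xH m c ^ i * grp m c (hh m)) := by
  have h : SemiconjBy (grp m c (hh m)) (yH m c) ((-1 : ℂ) • xH m c) := by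
    rw [SemiconjBy, h_mul_y, neg_one_smul, neg_mul]
  rw [← smul_mul_assoc, ← _root_.smul_pow]
  exact h.pow_right i

theorem grp_a_mul_x_pow (j : ZMod (2 * m)) (i : ℕ) :
    grp m c (a j) * xH m c ^ i = chi m j ^ i • (xH m c ^ i * grp m c (a j)) := by
  have h : SemiconjBy (grp m c (a j)) (xH m c) (chi m j • xH m c) := by
    rw [SemiconjBy, grp_a_mul_x, smul_mul_assoc]
  rw [← smul_mul_assoc, ← _root_.smul_pow]
  exact h.pow_right i

theorem grp_a_mul_y_pow (j : ZMod (2 * m)) (i : ℕ) :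
    grp m c (a j) * yH m c ^ i = (chi m j)⁻¹ ^ i • (yH m c ^ i * grp m c (a j)) := by
  have h : SemiconjBy (grp m c (a j)) (yH m c) ((chi m j)⁻¹ • yH m c) := by
    rw [SemiconjBy, grp_a_mul_y, smul_mul_assoc]
  rw [← smul_mul_assoc, ← _root_.smul_pow]
  exact h.pow_right i

/-! ### The products `xy` and `yx` as polynomials in `k` -/

/-- The substitution `i ↦ -i` in the sum defining `α`, using `c_{-i} = c_i`. -/
theorem alpha_neg_sub_one (hc : IsAdmissible m c) (q : ℤ) :
    alpha m c (-q - 1) = -alpha m c q := by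
  rw [alpha_eq_sum, alpha_eq_sum, ← mul_neg, ← Finset.sum_neg_distrib]
  congr 1
  refine Fintype.sum_equiv (Equiv.neg _) _ _ fun i => ?_
  rw [Equiv.neg_apply, coeff_neg_of_mem_center hc.mem_center, chi_neg, inv_zpow', neg_neg]
  by_cases hi : i = 0
  · simp [hi, chi_zero]
  · have h1 := sub_ne_zero.2 (chi_ne_one hi)
    have h2 : (1 : ℂ) - chi m i ≠ 0 := sub_ne_zero.2 (chi_ne_one hi).symm
    have h3 := chi_ne_zero i
    have h4 : (chi m i)⁻¹ - 1 ≠ 0 := by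
      rw [← chi_neg]
      exact sub_ne_zero.2 (chi_ne_one (neg_ne_zero.2 hi))
    rw [show -(-q - 1) = q + 1 by ring, zpow_add_one₀ h3]
    field_simp
    ring

/-- The polynomial `P_q = c₀ (X + 1/2 - α_q)`, for which `x y e_q = P_q(k) e_q`. -/
noncomputable def xyPoly (m : ℕ) (c : MonoidAlgebra ℂ (Dic m)) (q : ℤ) : ℂ[X] :=
  C (coef m c 0) * (X + C (1 / 2 - alpha m c q))

theorem x_mul_y_mul_E (hc : IsAdmissible m c) (q : ℤ) :
    xH m c * yH m c * E m c q = aeval (K m c) (xyPoly m c q) * E m c q := by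
  have hc0 : coef m c 0 ≠ 0 := by rw [coef_zero]; exact hc.coeff_one_ne_zero
  have h : K m c * E m c q = (coef m c 0)⁻¹ • (xH m c * yH m c * E m c q) +
      (alpha m c q - 1 / 2) • E m c q := by
    rw [K_eq_sum, sub_mul, smul_mul_assoc, add_mul, smul_add, sub_smul, add_sub_assoc,
      ← Algebra.smul_def, alpha_eq_sum, mul_smul, Finset.sum_smul, Finset.sum_mul]
    congr 4
    ext i
    rw [smul_mul_assoc, grp_a_mul_E, smul_smul, div_mul_eq_mul_div]
  simp only [xyPoly, map_mul, map_add, aeval_X, aeval_C]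
  rw [mul_assoc (algebraMap ℂ (H m c) (coef m c 0)), add_mul, h,
    ← Algebra.smul_def, ← Algebra.smul_def, add_assoc, ← add_smul,
    smul_add, smul_smul, mul_inv_cancel₀ hc0, one_smul]
  simp

/-- The conjugate by `h` of `x y e_{-q} = P_{-q}(k) e_{-q}`, rewritten with `α_{q-1} = -α_{-q}`. -/
theorem y_mul_x_mul_E (hc : IsAdmissible m c) (q : ℤ) :
    yH m c * xH m c * E m c q = aeval (K m c) (taylor (-1) (xyPoly m c (q - 1))) * E m c q := by
  have h : yH m c * xH m c * E m c q * grp m c (hh m) =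
      aeval (K m c) (taylor (-1) (xyPoly m c (q - 1))) * E m c q * grp m c (hh m) := by
    have h1 := congrArg (grp m c (hh m) * ·) (x_mul_y_mul_E hc (-q))
    rw [← mul_assoc, ← mul_assoc, ← mul_assoc, h_mul_x, mul_assoc (yH m c), h_mul_y, mul_neg,
      neg_mul, h_mul_aeval_K hc, aeval_neg_K, neg_eq_iff_eq_neg, ← neg_mul, ← neg_mul,
      ← map_neg] at h1
    simp only [mul_assoc, h_mul_E, neg_neg] at h1
    simp only [mul_assoc]
    rw [h1]
    congr 2
    have : alpha m c (q - 1) = -alpha m c (-q) := by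
      rw [← alpha_neg_sub_one hc, neg_neg]
    simp only [xyPoly, this, taylor_mul, taylor_C, map_add, taylor_X, mul_comp, add_comp, C_comp,
      X_comp]
    simp only [map_sub, map_neg, one_div, map_one]
    have h2 : (C (2 : ℂ)⁻¹ : ℂ[X]) + C (2 : ℂ)⁻¹ = 1 := by
      rw [← C_add, ← C_1]; norm_num
    linear_combination (-C (coef m c 0)) * h2
  simpa only [mul_assoc, grp_mul_grp_inv, mul_one] using congrArg (· * grp m c (hh m)⁻¹) h

theorem x_mul_y_mul_y_pow_mul_E (hc : IsAdmissible m c) (i : ℕ) (q : ℤ) :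
    xH m c * yH m c * yH m c ^ i * E m c q =
      yH m c ^ i * (aeval (K m c) (taylor (i : ℂ) (xyPoly m c (q + i))) * E m c q) := by
  have h : yH m c ^ i * E m c q = E m c (q + i) * yH m c ^ i := by
    rw [E_mul_y_pow, add_sub_cancel_right]
  rw [mul_assoc, h, ← mul_assoc, x_mul_y_mul_E hc, mul_assoc, ← h, ← mul_assoc,
    aeval_K_mul_y_pow hc, mul_assoc]

theorem y_mul_x_mul_x_pow_mul_E (hc : IsAdmissible m c) (i : ℕ) (q : ℤ) :
    yH m c * xH m c * xH m c ^ i * E m c q =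
      xH m c ^ i * (aeval (K m c) (taylor (-(i : ℂ) - 1) (xyPoly m c (q - i - 1))) *
        E m c q) := by
  have h : xH m c ^ i * E m c q = E m c (q - i) * xH m c ^ i := by
    rw [E_mul_x_pow, sub_add_cancel]
  rw [mul_assoc, h, ← mul_assoc, y_mul_x_mul_E hc, mul_assoc, ← h, ← mul_assoc,
    aeval_K_mul_x_pow hc, mul_assoc, taylor_taylor, sub_eq_add_neg (-(i : ℂ))]

theorem x_mul_y_pow_succ_mul_aeval_mul_E (hc : IsAdmissible m c) (i : ℕ) (R : ℂ[X]) (q : ℤ) :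
    xH m c * (yH m c ^ (i + 1) * aeval (K m c) R * E m c q) =
      yH m c ^ i * aeval (K m c) (taylor (i : ℂ) (xyPoly m c (q + i)) * R) * E m c q := by
  rw [mul_assoc _ (aeval (K m c) R), ← E_mul_aeval_K, pow_succ']
  simp only [← mul_assoc]
  rw [x_mul_y_mul_y_pow_mul_E hc]
  simp only [mul_assoc, map_mul]
  rw [E_mul_aeval_K]

/-! ### A spanning set -/

/-- `H_c` is spanned by the elements `xⁱ R(k) e_q s` and `yⁱ R(k) e_q s` with `s ∈ {1, h}`: the span
contains `1 = ∑ e_q` and is stable under left multiplication by the generators. -/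
theorem span_normalForms_eq_top (hc : IsAdmissible m c) :
    Submodule.span ℂ {b : H m c | ∃ u ∈ ({xH m c, yH m c} : Set (H m c)),
      ∃ s ∈ ({1, hh m} : Set (Dic m)), ∃ (i : ℕ) (R : ℂ[X]) (q : ℤ),
        b = u ^ i * aeval (K m c) R * E m c q * grp m c s} = ⊤ := by
  set W := Submodule.span ℂ {b : H m c | ∃ u ∈ ({xH m c, yH m c} : Set (H m c)),
      ∃ s ∈ ({1, hh m} : Set (Dic m)), ∃ (i : ℕ) (R : ℂ[X]) (q : ℤ),
        b = u ^ i * aeval (K m c) R * E m c q * grp m c s}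
  have hW : ∀ u ∈ ({xH m c, yH m c} : Set (H m c)), ∀ s ∈ ({1, hh m} : Set (Dic m)),
      ∀ (i : ℕ) (R : ℂ[X]) (q : ℤ), u ^ i * aeval (K m c) R * E m c q * grp m c s ∈ W :=
    fun u hu s hs i R q => Submodule.subset_span ⟨u, hu, s, hs, i, R, q, rfl⟩
  have mem_of (v : H m c) (hv : ∀ u ∈ ({xH m c, yH m c} : Set (H m c)),
      ∀ s ∈ ({1, hh m} : Set (Dic m)), ∀ (i : ℕ) (R : ℂ[X]) (q : ℤ),
        v * (u ^ i * aeval (K m c) R * E m c q * grp m c s) ∈ W) :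
      ∀ w ∈ W, v * w ∈ W := by
    intro w hw
    induction hw using Submodule.span_induction with
    | mem b hb =>
      obtain ⟨u, hu, s, hs, i, R, q, rfl⟩ := hb
      exact hv u hu s hs i R q
    | zero => rw [mul_zero]; exact W.zero_mem
    | add b d _ _ hb hd => rw [mul_add]; exact W.add_mem hb hd
    | smul z b _ hb => rw [mul_smul_comm]; exact W.smul_mem z hb
  have hx : ∀ w ∈ W, xH m c * w ∈ W := by
    refine mem_of _ ?_
    rintro u (rfl | rfl) s hs i R q
    · simp only [← mul_assoc]
      rw [← pow_succ']
      exact hW _ (by simp) s hs _ _ _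
    · cases i with
      | zero => simpa [mul_assoc] using hW (xH m c) (by simp) s hs 1 R q
      | succ i =>
        rw [← mul_assoc, x_mul_y_pow_succ_mul_aeval_mul_E hc]
        exact hW _ (by simp) s hs _ _ _
  have ha : ∀ j : ZMod (2 * m), ∀ w ∈ W, grp m c (a j) * w ∈ W := by
    intro j
    refine mem_of _ ?_
    rintro u (rfl | rfl) s hs i R q
    · simp only [← mul_assoc]
      rw [grp_a_mul_x_pow]
      simp only [smul_mul_assoc]
      rw [mul_assoc _ (grp m c (a j)), grp_a_mul_aeval_K, ← mul_assoc, mul_assoc _ (grp m c (a j)),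
        grp_a_mul_E, mul_smul_comm, smul_mul_assoc]
      exact W.smul_mem _ (W.smul_mem _ (hW _ (by simp) s hs _ _ _))
    · simp only [← mul_assoc]
      rw [grp_a_mul_y_pow]
      simp only [smul_mul_assoc]
      rw [mul_assoc _ (grp m c (a j)), grp_a_mul_aeval_K, ← mul_assoc, mul_assoc _ (grp m c (a j)),
        grp_a_mul_E, mul_smul_comm, smul_mul_assoc]
      exact W.smul_mem _ (W.smul_mem _ (hW _ (by simp) s hs _ _ _))
  -- moving `h` through `R(k) e_q` and absorbing `h² = gᵐ` into the idempotent
  have hhs : ∀ u ∈ ({xH m c, yH m c} : Set (H m c)), ∀ s ∈ ({1, hh m} : Set (Dic m)),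
      ∀ (i : ℕ) (R : ℂ[X]) (q : ℤ),
        u ^ i * grp m c (hh m) * aeval (K m c) R * E m c q * grp m c s ∈ W := by
    intro u hu s hs i R q
    rw [mul_assoc _ (grp m c (hh m)), h_mul_aeval_K hc, ← mul_assoc, mul_assoc _ (grp m c (hh m)),
      h_mul_E, ← mul_assoc, aeval_neg_K]
    rcases hs with rfl | rfl
    · rw [grp_one, mul_one]
      exact hW u hu _ (by simp) _ _ _
    · rw [mul_assoc _ (grp m c (hh m)), h_mul_h, mul_assoc _ (E m c (-q)), E_mul_grp_a,
        mul_smul_comm]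
      refine W.smul_mem _ ?_
      simpa [grp_one] using hW u hu 1 (by simp) i (R.comp (-X)) (-q)
  have hh' : ∀ w ∈ W, grp m c (hh m) * w ∈ W := by
    refine mem_of _ ?_
    rintro u (rfl | rfl) s hs i R q
    · simp only [← mul_assoc]
      rw [h_mul_x_pow]
      exact hhs _ (by simp) s hs _ _ _
    · simp only [← mul_assoc]
      rw [h_mul_y_pow]
      simp only [smul_mul_assoc]
      exact W.smul_mem _ (hhs _ (by simp) s hs _ _ _)
  let A : Subalgebra ℂ (H m c) :=
    { carrier := {b | ∀ w ∈ W, b * w ∈ W}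
      mul_mem' := fun {b d} hb hd w hw => by
        rw [mul_assoc]
        exact hb _ (hd w hw)
      add_mem' := fun {b d} hb hd w hw => by
        rw [add_mul]
        exact W.add_mem (hb w hw) (hd w hw)
      algebraMap_mem' := fun z w hw => by
        rw [← Algebra.smul_def]
        exact W.smul_mem z hw }
  have hA : A = ⊤ := by
    refine subalgebra_eq_top m c A hx ?_
    rintro (j | j)
    · exact ha j
    · rw [grp_xa]
      exact A.mul_mem hh' (ha j)
  have h1 : (1 : H m c) ∈ W := by
    rw [← sum_E]
    refine W.sum_mem fun q _ => ?_
    simpa [grp_one] using hW (xH m c) (by simp) 1 (by simp) 0 1 q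
  rw [eq_top_iff]
  rintro b -
  have hb : b ∈ A := hA ▸ Algebra.mem_top
  simpa using hb 1 h1

/-! ### Multiplying elements in normal form by `x` -/

theorem x_mul_y_mul_aeval_mul_E (hc : IsAdmissible m c) (R : ℂ[X]) (q : ℤ) :
    xH m c * yH m c * aeval (K m c) R * E m c q =
      aeval (K m c) (xyPoly m c q * R) * E m c q := by
  rw [mul_assoc, ← E_mul_aeval_K, ← mul_assoc, x_mul_y_mul_E hc, mul_assoc, E_mul_aeval_K, map_mul,
    mul_assoc]

theorem y_mul_x_mul_aeval_mul_E (hc : IsAdmissible m c) (R : ℂ[X]) (q : ℤ) :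
    yH m c * xH m c * aeval (K m c) R * E m c q =
      aeval (K m c) (taylor (-1) (xyPoly m c (q - 1)) * R) * E m c q := by
  rw [mul_assoc, ← E_mul_aeval_K, ← mul_assoc, y_mul_x_mul_E hc, mul_assoc, E_mul_aeval_K, map_mul,
    mul_assoc]

theorem aeval_mul_E_mul_x (hc : IsAdmissible m c) (R : ℂ[X]) (q : ℤ) :
    aeval (K m c) R * E m c q * xH m c =
      xH m c * aeval (K m c) (taylor (-1) R) * E m c (q + 1) := by
  have h1 := E_mul_x_pow (m := m) (c := c) q 1
  have h2 := aeval_K_mul_x_pow hc R 1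
  simp only [pow_one, Nat.cast_one] at h1 h2
  rw [mul_assoc, h1, ← mul_assoc, h2]

theorem aeval_mul_E_mul_h_mul_x (hc : IsAdmissible m c) (R : ℂ[X]) (q : ℤ) :
    aeval (K m c) R * E m c q * grp m c (hh m) * xH m c =
      yH m c * aeval (K m c) (taylor 1 R) * E m c (q - 1) * grp m c (hh m) := by
  have h1 := E_mul_y_pow (m := m) (c := c) q 1
  have h2 := aeval_K_mul_y_pow hc R 1
  simp only [pow_one, Nat.cast_one] at h1 h2
  rw [mul_assoc, h_mul_x, ← mul_assoc, mul_assoc _ (E m c q), h1, ← mul_assoc, h2]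

/-! ### Traces satisfy the conditions -/

theorem IsTrace.map_conj {T : H m c →ₗ[ℂ] ℂ} (hT : IsTrace m c T) (s : Dic m) (b : H m c) :
    T (grp m c s * b * grp m c s⁻¹) = T b := by
  rw [hT, ← mul_assoc, grp_inv_mul_grp, one_mul]

/-- The commutators `[k, xⁱ b] = -i xⁱ b`, for `b` commuting with `k`, are killed by a trace. -/
theorem IsTrace.map_x_pow_eq_zero {T : H m c →ₗ[ℂ] ℂ} (hT : IsTrace m c T)
    (hc : IsAdmissible m c) {i : ℕ} (hi : i ≠ 0) (R : ℂ[X]) (q : ℤ) :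
    T (xH m c ^ i * aeval (K m c) R * E m c q) = 0 := by
  have h := hT (K m c) (xH m c ^ i * aeval (K m c) R * E m c q)
  have h1 := aeval_K_mul_x_pow hc X i
  have h2 : E m c q * K m c = K m c * E m c q := commute_E_K m c q
  have h3 : aeval (K m c) R * K m c = K m c * aeval (K m c) R :=
    (SemiconjBy.aeval (Commute.refl (K m c)) R).symm
  simp only [aeval_X, taylor_X, map_add, aeval_C] at h1
  rw [mul_assoc _ (E m c q), h2] at h
  simp only [← mul_assoc] at h
  rw [mul_assoc _ _ (K m c), h3, ← mul_assoc, h1, mul_add, add_mul, add_mul, map_add,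
    ← Algebra.commutes, ← Algebra.smul_def,
    smul_mul_assoc, smul_mul_assoc, map_smul, add_eq_left] at h
  simpa [hi] using h

theorem IsTrace.map_y_pow_eq_zero {T : H m c →ₗ[ℂ] ℂ} (hT : IsTrace m c T)
    (hc : IsAdmissible m c) {i : ℕ} (hi : i ≠ 0) (R : ℂ[X]) (q : ℤ) :
    T (yH m c ^ i * aeval (K m c) R * E m c q) = 0 := by
  rw [← hT.map_conj (hh m)]
  simp only [← mul_assoc]
  rw [h_mul_y_pow]
  simp only [smul_mul_assoc]
  rw [mul_assoc _ (grp m c (hh m)), h_mul_aeval_K hc, ← mul_assoc, mul_assoc _ (grp m c (hh m)),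
    h_mul_E, ← mul_assoc, mul_assoc _ (grp m c (hh m)), grp_mul_grp_inv, mul_one, map_smul,
    aeval_neg_K, hT.map_x_pow_eq_zero hc hi, smul_zero]

/-- Conjugation by `gᵐ = h²` multiplies `x` and `y` by `-1` and fixes `R(k) e_q h`. -/
theorem map_pow_mul_h_eq_zero {T : H m c →ₗ[ℂ] ℂ}
    (h1 : ∀ (s : Dic m) (b : H m c), T (grp m c s * b * grp m c s⁻¹) = T b)
    {i : ℕ} (hi : ¬ 2 ∣ i) (R : ℂ[X]) (q : ℤ) :
    T (xH m c ^ i * aeval (K m c) R * E m c q * grp m c (hh m)) = 0 ∧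
      T (yH m c ^ i * aeval (K m c) R * E m c q * grp m c (hh m)) = 0 := by
  have key : ∀ u : H m c, grp m c (a (m : ZMod (2 * m))) * u ^ i =
      (-1 : ℂ) • (u ^ i * grp m c (a (m : ZMod (2 * m)))) →
      T (u ^ i * aeval (K m c) R * E m c q * grp m c (hh m)) = 0 := by
    intro u hu
    have hgh : grp m c (a (m : ZMod (2 * m))) * grp m c (hh m) =
        grp m c (hh m) * grp m c (a (m : ZMod (2 * m))) := by
      rw [← h_mul_h, mul_assoc]
    have hE : grp m c (a (m : ZMod (2 * m))) * E m c q =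
        E m c q * grp m c (a (m : ZMod (2 * m))) := by
      rw [grp_a_mul_E, E_mul_grp_a]
    have h := h1 (a (m : ZMod (2 * m))) (u ^ i * aeval (K m c) R * E m c q * grp m c (hh m))
    simp only [← mul_assoc] at h
    rw [hu] at h
    simp only [smul_mul_assoc] at h
    rw [mul_assoc (u ^ i), grp_a_mul_aeval_K, ← mul_assoc, mul_assoc (u ^ i * _), hE, ← mul_assoc,
      mul_assoc (u ^ i * _ * _), hgh, ← mul_assoc,
      mul_assoc _ (grp m c (a (m : ZMod (2 * m)))), grp_mul_grp_inv, mul_one, map_smul] at h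
    rw [smul_eq_mul] at h
    linear_combination (-1 / 2) * h
  have hodd : Odd i := by rwa [← Nat.not_even_iff_odd, even_iff_two_dvd]
  constructor
  · apply key
    rw [grp_a_mul_x_pow, chi_half, hodd.neg_one_pow]
  · apply key
    rw [grp_a_mul_y_pow, chi_half, inv_neg_one, hodd.neg_one_pow]

theorem IsTrace.map_x_pow_two_mul {T : H m c →ₗ[ℂ] ℂ} (hT : IsTrace m c T)
    (hc : IsAdmissible m c) (i : ℕ) (R S : ℂ[X]) (q : ℤ)
    (hS : xH m c ^ i * yH m c ^ i * E m c (q - i) = aeval (K m c) S * E m c (q - i)) :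
    T (xH m c ^ (2 * i) * aeval (K m c) R * E m c q * grp m c (hh m)) =
      T (aeval (K m c) S * polyK m c R i * E m c (q - i) * grp m c (hh m)) := by
  rw [two_mul, pow_add]
  simp only [mul_assoc]
  rw [hT]
  simp only [mul_assoc]
  rw [h_mul_x_pow, ← mul_assoc (E m c q), E_mul_y_pow, ← mul_assoc (aeval (K m c) R), ← mul_assoc
    (aeval (K m c) R), aeval_K_mul_y_pow hc, polyK_eq, ← mul_assoc (xH m c ^ i),
    mul_assoc (yH m c ^ i), ← E_mul_aeval_K, ← mul_assoc, ← mul_assoc, hS, mul_assoc _ (E m c _),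
    E_mul_aeval_K]
  simp only [mul_assoc]

theorem IsTrace.map_y_pow_two_mul {T : H m c →ₗ[ℂ] ℂ} (hT : IsTrace m c T)
    (hc : IsAdmissible m c) (i : ℕ) (R S : ℂ[X]) (q : ℤ)
    (hS : yH m c ^ i * xH m c ^ i * E m c (q + i) = aeval (K m c) S * E m c (q + i)) :
    T (yH m c ^ (2 * i) * aeval (K m c) R * E m c q * grp m c (hh m)) =
      (-1) ^ i * T (aeval (K m c) S * polyK m c R (-i) * E m c (q + i) * grp m c (hh m)) := by
  rw [two_mul, pow_add]
  simp only [mul_assoc]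
  rw [hT]
  simp only [mul_assoc]
  rw [h_mul_y_pow]
  simp only [mul_smul_comm, map_smul, smul_eq_mul]
  congr 2
  rw [← mul_assoc (E m c q), E_mul_x_pow, ← mul_assoc (aeval (K m c) R), ← mul_assoc
    (aeval (K m c) R), aeval_K_mul_x_pow hc, polyK_eq, ← mul_assoc (yH m c ^ i),
    mul_assoc (xH m c ^ i), ← E_mul_aeval_K, ← mul_assoc, ← mul_assoc, hS, mul_assoc _ (E m c _),
    E_mul_aeval_K]
  simp only [mul_assoc]

theorem IsTrace.map_K_pow_mul_E_mul_h {T : H m c →ₗ[ℂ] ℂ} (hT : IsTrace m c T)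
    (hc : IsAdmissible m c) {i : ℕ} (hi : 0 < i) (q : ℤ) :
    T (K m c ^ i * E m c q * grp m c (hh m)) = 0 := by
  obtain ⟨i, rfl⟩ := Nat.exists_eq_succ_of_ne_zero hi.ne'
  have h := hT (K m c) (K m c ^ i * E m c q * grp m c (hh m))
  have hE : E m c q * K m c = K m c * E m c q := commute_E_K m c q
  rw [mul_assoc _ _ (K m c), h_mul_K hc, neg_mul, mul_neg] at h
  simp only [← mul_assoc] at h
  rw [mul_assoc _ _ (K m c), hE, ← mul_assoc, ← pow_succ, ← pow_succ', map_neg] at h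
  exact self_eq_neg.1 h

theorem IsTrace.map_shift {T : H m c →ₗ[ℂ] ℂ} (hT : IsTrace m c T)
    (hc : IsAdmissible m c) (q : ℤ) (R : ℂ[X]) :
    T (aeval (K m c) (xyPoly m c q * R) * E m c q) =
      T (aeval (K m c) (taylor (-1) (xyPoly m c q * R)) * E m c (q + 1)) := by
  rw [← x_mul_y_mul_aeval_mul_E hc, mul_assoc, mul_assoc, hT, mul_assoc,
    aeval_mul_E_mul_x hc, ← mul_assoc, ← mul_assoc, y_mul_x_mul_aeval_mul_E hc,
    add_sub_cancel_right, taylor_mul]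

theorem IsTrace.map_even {T : H m c →ₗ[ℂ] ℂ} (hT : IsTrace m c T)
    (hc : IsAdmissible m c) (q : ℤ) (R : ℂ[X]) :
    T (aeval (K m c) R * E m c q) = T (aeval (-K m c) R * E m c (-q)) := by
  rw [← hT.map_conj (hh m), ← mul_assoc, h_mul_aeval_K hc, mul_assoc (aeval _ R), h_mul_E,
    ← mul_assoc, mul_assoc _ (grp m c (hh m)), grp_mul_grp_inv, mul_one]

/-! ### The conditions imply the trace property -/

/-- The two sides of the shift condition are, up to the factor `c₀`, the values on `x y R(k) e_q`
and `y R(k) e_q x`. -/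
theorem shift_iff (hc : IsAdmissible m c) (T : H m c →ₗ[ℂ] ℂ) :
    (∀ (q : ℤ) (R : ℂ[X]),
      T ((K m c + algebraMap ℂ (H m c) (1 / 2 - alpha m c q)) * polyK m c R (1 / 2) * E m c q) =
        T ((K m c + algebraMap ℂ (H m c) (-(1 / 2) - alpha m c q)) * polyK m c R (-(1 / 2)) *
          E m c (q + 1))) ↔
    ∀ (q : ℤ) (R : ℂ[X]), T (aeval (K m c) (xyPoly m c q * R) * E m c q) =
      T (aeval (K m c) (taylor (-1) (xyPoly m c q * R)) * E m c (q + 1)) := by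
  have hc0 : coef m c 0 ≠ 0 := by rw [coef_zero]; exact hc.coeff_one_ne_zero
  have hl : ∀ (q : ℤ) (R : ℂ[X]), T (aeval (K m c) (xyPoly m c q * taylor (1 / 2) R) * E m c q) =
      coef m c 0 * T ((K m c + algebraMap ℂ (H m c) (1 / 2 - alpha m c q)) *
        polyK m c R (1 / 2) * E m c q) := by
    intro q R
    rw [polyK_eq, xyPoly, aeval_mul, aeval_mul, aeval_add, aeval_X, aeval_C, aeval_C, mul_assoc,
      mul_assoc, ← Algebra.smul_def, map_smul, smul_eq_mul, ← mul_assoc]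
  have hr : ∀ (q : ℤ) (R : ℂ[X]),
      T (aeval (K m c) (taylor (-1) (xyPoly m c q * taylor (1 / 2) R)) * E m c (q + 1)) =
      coef m c 0 * T ((K m c + algebraMap ℂ (H m c) (-(1 / 2) - alpha m c q)) *
        polyK m c R (-(1 / 2)) * E m c (q + 1)) := by
    intro q R
    rw [polyK_eq, taylor_mul, taylor_taylor, xyPoly, taylor_mul, map_add, taylor_C, taylor_C,
      taylor_X, add_assoc, ← C_add, aeval_mul, aeval_mul, aeval_add, aeval_X, aeval_C, aeval_C, mul_assoc,
      mul_assoc, ← Algebra.smul_def, map_smul, smul_eq_mul, ← mul_assoc,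
      show (-1 : ℂ) + (1 / 2 - alpha m c q) = -(1 / 2) - alpha m c q by ring,
      show (-1 : ℂ) + 1 / 2 = -(1 / 2) by ring]
  constructor
  · intro h q R
    have h' := congrArg (coef m c 0 * ·) (h q (taylor (-(1 / 2)) R))
    simp only [← hl, ← hr, taylor_taylor] at h'
    simpa using h'
  · intro h q R
    apply mul_left_cancel₀ hc0
    rw [← hl, ← hr]
    exact h q _

/-- If `e_r = e_{-r}`, then `r` may be replaced by `-r` in the index of `α`. -/
theorem alpha_congr (r t : ℤ) (hr : eps m ^ (2 * r) = 1) :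
    alpha m c (r + t) = alpha m c (-r + t) := by
  rw [alpha_eq_sum, alpha_eq_sum]
  congr 1
  refine Finset.sum_congr rfl fun i _ => ?_
  have h : chi m i ^ (2 * r) = 1 := by
    rw [chi, ← zpow_natCast, zpow_comm, hr, one_zpow]
  rw [show -(-r + t) = -(r + t) + 2 * r by ring, zpow_add₀ (chi_ne_zero i), h, mul_one]

/-- Conjugation by `g` multiplies `e_r h` by `ε^{-2r}`, so `T(e_r h) = 0` unless `e_r = e_{-r}`; in
the latter case `α_{r-j-1} = α_{-r-j-1} = -α_{r+j}`. -/
theorem alpha_add_alpha_mul_map_E_mul_h (hc : IsAdmissible m c) {T : H m c →ₗ[ℂ] ℂ}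
    (h1 : ∀ (s : Dic m) (b : H m c), T (grp m c s * b * grp m c s⁻¹) = T b) (r j : ℤ) :
    (alpha m c (r + j) + alpha m c (r - j - 1)) * T (E m c r * grp m c (hh m)) = 0 := by
  by_cases hr : eps m ^ (2 * r) = 1
  · rw [sub_sub, sub_eq_add_neg r, alpha_congr r (-(j + 1)) hr,
      show -r + -(j + 1) = -(r + j) - 1 by ring, alpha_neg_sub_one hc, add_neg_cancel, zero_mul]
  · have h := h1 (a 1) (E m c r * grp m c (hh m))
    have hinv : (a 1 : Dic m)⁻¹ = a (-1) := rfl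
    rw [hinv, ← mul_assoc, grp_a_mul_E, mul_assoc, h_mul_grp_a, neg_neg, smul_mul_assoc,
      ← mul_assoc, E_mul_grp_a, smul_mul_assoc, smul_smul, map_smul, chi_one,
      ← zpow_add₀ (eps_ne_zero m), ← two_mul, mul_neg, zpow_neg, smul_eq_mul] at h
    have h0 : T (E m c r * grp m c (hh m)) = 0 := by
      by_contra h0
      exact hr (inv_eq_one.1 (mul_right_cancel₀ h0 (h.trans (one_mul _).symm)))
    rw [h0, mul_zero]

/-- By the condition on `k^i e_q h`, only the value at `0` of a polynomial matters. -/
theorem map_aeval_mul_E_mul_h {T : H m c →ₗ[ℂ] ℂ}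
    (h6 : ∀ (i : ℕ) (q : ℤ), 0 < i → T (K m c ^ i * E m c q * grp m c (hh m)) = 0)
    (R : ℂ[X]) (q : ℤ) :
    T (aeval (K m c) R * E m c q * grp m c (hh m)) =
      R.eval 0 * T (E m c q * grp m c (hh m)) := by
  induction R using Polynomial.induction_on' with
  | add p q hp hq => rw [map_add, add_mul, add_mul, map_add, hp, hq, eval_add, add_mul]
  | monomial n z =>
    rw [aeval_monomial, ← Algebra.smul_def, smul_mul_assoc, smul_mul_assoc, map_smul, smul_eq_mul,
      eval_monomial]
    rcases n.eq_zero_or_pos with rfl | hn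
    · simp
    · rw [h6 n q hn, zero_pow hn.ne', mul_zero, zero_mul]

/-- The trace property need only be checked against the generator `x`, given conjugation invariance. -/
theorem isTrace_of_x_mul {T : H m c →ₗ[ℂ] ℂ}
    (h1 : ∀ (s : Dic m) (b : H m c), T (grp m c s * b * grp m c s⁻¹) = T b)
    (hx : ∀ b, T (xH m c * b) = T (b * xH m c)) : IsTrace m c T := by
  let A : Subalgebra ℂ (H m c) :=
    { carrier := {b | ∀ d, T (b * d) = T (d * b)}
      mul_mem' := fun {b b'} hb hb' d => by
        rw [mul_assoc, hb, mul_assoc, hb', mul_assoc]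
      add_mem' := fun {b b'} hb hb' d => by
        rw [add_mul, mul_add, map_add, map_add, hb, hb']
      algebraMap_mem' := fun z d => by rw [Algebra.commutes] }
  have hA : A = ⊤ := by
    refine subalgebra_eq_top m c A hx fun s d => ?_
    rw [← h1 s (d * grp m c s), ← mul_assoc, mul_assoc _ _ (grp m c s⁻¹), grp_mul_grp_inv, mul_one]
  intro b
  have hb : b ∈ A := hA ▸ Algebra.mem_top
  exact hb

theorem x_pow_succ_mul_y_pow_succ_mul_E (hc : IsAdmissible m c) {i : ℕ} {q : ℤ} {S : ℂ[X]}
    (hS : xH m c ^ i * yH m c ^ i * E m c q = aeval (K m c) S * E m c q) :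
    xH m c ^ (i + 1) * yH m c ^ (i + 1) * E m c q =
      aeval (K m c) (S * taylor (i : ℂ) (xyPoly m c (q + i))) * E m c q := by
  rw [pow_succ, pow_succ', mul_assoc (xH m c ^ i), ← mul_assoc (xH m c), mul_assoc,
    x_mul_y_mul_y_pow_mul_E hc, ← E_mul_aeval_K, ← mul_assoc, ← mul_assoc, hS, mul_assoc,
    E_mul_aeval_K, map_mul, mul_assoc]

theorem y_pow_succ_mul_x_pow_succ_mul_E (hc : IsAdmissible m c) {i : ℕ} {q : ℤ} {S : ℂ[X]}
    (hS : yH m c ^ i * xH m c ^ i * E m c q = aeval (K m c) S * E m c q) :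
    yH m c ^ (i + 1) * xH m c ^ (i + 1) * E m c q =
      aeval (K m c) (S * taylor (-(i : ℂ) - 1) (xyPoly m c (q - i - 1))) * E m c q := by
  rw [pow_succ, pow_succ', mul_assoc (yH m c ^ i), ← mul_assoc (yH m c), mul_assoc,
    y_mul_x_mul_x_pow_mul_E hc, ← E_mul_aeval_K, ← mul_assoc, ← mul_assoc, hS, mul_assoc,
    E_mul_aeval_K, map_mul, mul_assoc]

theorem exists_x_pow_mul_y_pow_mul_E (hc : IsAdmissible m c) (i : ℕ) (q : ℤ) :
    ∃ S : ℂ[X], xH m c ^ i * yH m c ^ i * E m c q = aeval (K m c) S * E m c q := by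
  induction i with
  | zero => exact ⟨1, by simp⟩
  | succ i ih => exact ih.elim fun S hS => ⟨_, x_pow_succ_mul_y_pow_succ_mul_E hc hS⟩

theorem exists_y_pow_mul_x_pow_mul_E (hc : IsAdmissible m c) (i : ℕ) (q : ℤ) :
    ∃ S : ℂ[X], yH m c ^ i * xH m c ^ i * E m c q = aeval (K m c) S * E m c q := by
  induction i with
  | zero => exact ⟨1, by simp⟩
  | succ i ih => exact ih.elim fun S hS => ⟨_, y_pow_succ_mul_x_pow_succ_mul_E hc hS⟩

section Conditions

variable {T : H m c →ₗ[ℂ] ℂ}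

theorem map_x_mul_x_pow
    (h2 : ∀ (i : ℕ) (R : ℂ[X]) (q : ℤ), i ≠ 0 →
      T (xH m c ^ i * aeval (K m c) R * E m c q) = 0)
    (hc : IsAdmissible m c) (i : ℕ) (R : ℂ[X]) (q : ℤ) :
    T (xH m c * (xH m c ^ i * aeval (K m c) R * E m c q)) =
      T (xH m c ^ i * aeval (K m c) R * E m c q * xH m c) := by
  have hl : xH m c * (xH m c ^ i * aeval (K m c) R * E m c q) =
      xH m c ^ (i + 1) * aeval (K m c) R * E m c q := by
    simp only [pow_succ', mul_assoc]
  have hr : xH m c ^ i * aeval (K m c) R * E m c q * xH m c =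
      xH m c ^ (i + 1) * aeval (K m c) (taylor (-1) R) * E m c (q + 1) := by
    rw [mul_assoc (xH m c ^ i), mul_assoc (xH m c ^ i), aeval_mul_E_mul_x hc, pow_succ]
    simp only [mul_assoc]
  rw [hl, hr, h2 _ _ _ i.succ_ne_zero, h2 _ _ _ i.succ_ne_zero]

/-- The case `i = 1` is the shift condition. -/
theorem map_x_mul_y_pow
    (h2 : ∀ (i : ℕ) (R : ℂ[X]) (q : ℤ), i ≠ 0 →
      T (xH m c ^ i * aeval (K m c) R * E m c q) = 0 ∧
      T (yH m c ^ i * aeval (K m c) R * E m c q) = 0)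
    (h7 : ∀ (q : ℤ) (R : ℂ[X]), T (aeval (K m c) (xyPoly m c q * R) * E m c q) =
      T (aeval (K m c) (taylor (-1) (xyPoly m c q * R)) * E m c (q + 1)))
    (hc : IsAdmissible m c) (i : ℕ) (R : ℂ[X]) (q : ℤ) :
    T (xH m c * (yH m c ^ i * aeval (K m c) R * E m c q)) =
      T (yH m c ^ i * aeval (K m c) R * E m c q * xH m c) := by
  cases i with
  | zero => simpa using map_x_mul_x_pow (fun i R q hi => (h2 i R q hi).1) hc 0 R q
  | succ i =>
    have hr : yH m c ^ (i + 1) * aeval (K m c) R * E m c q * xH m c =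
        yH m c ^ i * aeval (K m c) (taylor (-1) (xyPoly m c q * R)) * E m c (q + 1) := by
      rw [mul_assoc (yH m c ^ (i + 1)), mul_assoc (yH m c ^ (i + 1)), aeval_mul_E_mul_x hc,
        pow_succ, mul_assoc (yH m c ^ i), ← mul_assoc (yH m c), ← mul_assoc (yH m c),
        y_mul_x_mul_aeval_mul_E hc, add_sub_cancel_right, taylor_mul, mul_assoc]
    rw [x_mul_y_pow_succ_mul_aeval_mul_E hc, hr]
    rcases eq_or_ne i 0 with rfl | hi
    · simpa using h7 q R
    · rw [(h2 _ _ _ hi).2, (h2 _ _ _ hi).2]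

theorem map_x_mul_x_pow_mul_h
    (h3 : ∀ (i : ℕ) (R : ℂ[X]) (q : ℤ), ¬ 2 ∣ i →
      T (xH m c ^ i * aeval (K m c) R * E m c q * grp m c (hh m)) = 0 ∧
      T (yH m c ^ i * aeval (K m c) R * E m c q * grp m c (hh m)) = 0)
    (h4 : ∀ (i : ℕ) (R S : ℂ[X]) (q : ℤ),
      xH m c ^ i * yH m c ^ i * E m c (q - i) = aeval (K m c) S * E m c (q - i) →
      T (xH m c ^ (2 * i) * aeval (K m c) R * E m c q * grp m c (hh m)) =
        T (aeval (K m c) S * polyK m c R i * E m c (q - i) * grp m c (hh m)))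
    (hc : IsAdmissible m c) (i : ℕ) (R : ℂ[X]) (q : ℤ) :
    T (xH m c * (xH m c ^ i * aeval (K m c) R * E m c q * grp m c (hh m))) =
      T (xH m c ^ i * aeval (K m c) R * E m c q * grp m c (hh m) * xH m c) := by
  have hl : xH m c * (xH m c ^ i * aeval (K m c) R * E m c q * grp m c (hh m)) =
      xH m c ^ (i + 1) * aeval (K m c) R * E m c q * grp m c (hh m) := by
    simp only [pow_succ', mul_assoc]
  have hr : xH m c ^ i * aeval (K m c) R * E m c q * grp m c (hh m) * xH m c =
      xH m c ^ i * yH m c * aeval (K m c) (taylor 1 R) * E m c (q - 1) * grp m c (hh m) := by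
    rw [mul_assoc (xH m c ^ i), mul_assoc (xH m c ^ i), mul_assoc (xH m c ^ i),
      aeval_mul_E_mul_h_mul_x hc]
    simp only [mul_assoc]
  have hr' : ∀ i, xH m c ^ (i + 1) * yH m c * aeval (K m c) (taylor 1 R) * E m c (q - 1) =
      xH m c ^ i * aeval (K m c) (xyPoly m c (q - 1) * taylor 1 R) * E m c (q - 1) := by
    intro i
    rw [mul_assoc (xH m c ^ i), ← x_mul_y_mul_aeval_mul_E hc, pow_succ]
    simp only [mul_assoc]
  rw [hl, hr]
  rcases Nat.even_or_odd' i with ⟨j, rfl | rfl⟩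
  · rw [(h3 _ _ _ (by omega)).1]
    cases j with
    | zero => simpa using (h3 1 (taylor 1 R) (q - 1) (by omega)).2.symm
    | succ j => rw [show 2 * (j + 1) = 2 * j + 1 + 1 by ring, hr', (h3 _ _ _ (by omega)).1]
  · obtain ⟨S, hS⟩ := exists_x_pow_mul_y_pow_mul_E hc j (q - 1 - j)
    have hS' := x_pow_succ_mul_y_pow_succ_mul_E hc hS
    have hq : q - 1 - (j : ℤ) = q - (j + 1 : ℕ) := by push_cast; ring
    rw [sub_add_cancel] at hS'
    rw [hr', h4 j _ S _ hS, show 2 * j + 1 + 1 = 2 * (j + 1) by ring]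
    rw [hq] at hS' ⊢
    rw [h4 (j + 1) R _ q hS', polyK_eq, polyK_eq, taylor_mul, taylor_taylor, Nat.cast_succ,
      aeval_mul, aeval_mul]
    simp only [mul_assoc]

/-- For odd `i` both sides reduce, by the conditions on `y^{2i} R(k) e_q h` and on `kⁱ e_q h`, to
multiples of `T(e_r h)`, and their difference to `(α_{r+j} + α_{r-j-1}) T(e_r h)`. -/
theorem map_x_mul_y_pow_mul_h
    (h1 : ∀ (s : Dic m) (b : H m c), T (grp m c s * b * grp m c s⁻¹) = T b)
    (h3 : ∀ (i : ℕ) (R : ℂ[X]) (q : ℤ), ¬ 2 ∣ i →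
      T (xH m c ^ i * aeval (K m c) R * E m c q * grp m c (hh m)) = 0 ∧
      T (yH m c ^ i * aeval (K m c) R * E m c q * grp m c (hh m)) = 0)
    (h5 : ∀ (i : ℕ) (R S : ℂ[X]) (q : ℤ),
      yH m c ^ i * xH m c ^ i * E m c (q + i) = aeval (K m c) S * E m c (q + i) →
      T (yH m c ^ (2 * i) * aeval (K m c) R * E m c q * grp m c (hh m)) =
        (-1) ^ i * T (aeval (K m c) S * polyK m c R (-i) * E m c (q + i) * grp m c (hh m)))
    (h6 : ∀ (i : ℕ) (q : ℤ), 0 < i → T (K m c ^ i * E m c q * grp m c (hh m)) = 0)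
    (hc : IsAdmissible m c) (i : ℕ) (R : ℂ[X]) (q : ℤ) :
    T (xH m c * (yH m c ^ i * aeval (K m c) R * E m c q * grp m c (hh m))) =
      T (yH m c ^ i * aeval (K m c) R * E m c q * grp m c (hh m) * xH m c) := by
  have hl : ∀ i : ℕ, xH m c * (yH m c ^ (i + 1) * aeval (K m c) R * E m c q * grp m c (hh m)) =
      yH m c ^ i * aeval (K m c) (taylor (i : ℂ) (xyPoly m c (q + i)) * R) * E m c q *
        grp m c (hh m) := by
    intro i
    rw [← mul_assoc, x_mul_y_pow_succ_mul_aeval_mul_E hc]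
  have hr : yH m c ^ i * aeval (K m c) R * E m c q * grp m c (hh m) * xH m c =
      yH m c ^ (i + 1) * aeval (K m c) (taylor 1 R) * E m c (q - 1) * grp m c (hh m) := by
    rw [mul_assoc (yH m c ^ i), mul_assoc (yH m c ^ i), mul_assoc (yH m c ^ i),
      aeval_mul_E_mul_h_mul_x hc, pow_succ]
    simp only [mul_assoc]
  rw [hr]
  rcases Nat.even_or_odd' i with ⟨j, rfl | rfl⟩
  · rw [(h3 _ _ _ (by omega)).2]
    cases j with
    | zero => simpa [mul_assoc] using (h3 1 R q (by omega)).1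
    | succ j => rw [show 2 * (j + 1) = 2 * j + 1 + 1 by ring, hl, (h3 _ _ _ (by omega)).2]
  · obtain ⟨S, hS⟩ := exists_y_pow_mul_x_pow_mul_E hc j (q + j)
    have hS' := y_pow_succ_mul_x_pow_succ_mul_E hc hS
    have hq : q - 1 + ((j + 1 : ℕ) : ℤ) = q + j := by push_cast; ring
    rw [hl, h5 j _ S _ hS, show 2 * j + 1 + 1 = 2 * (j + 1) by ring,
      h5 (j + 1) _ _ (q - 1) (by rw [hq]; exact hS'), hq, polyK_eq, polyK_eq, ← aeval_mul,
      ← aeval_mul, map_aeval_mul_E_mul_h h6, map_aeval_mul_E_mul_h h6]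
    have hα := alpha_add_alpha_mul_map_E_mul_h hc h1 (q + j) j
    rw [show q + ((2 * j : ℕ) : ℤ) = q + j + j by push_cast; ring]
    simp only [eval_mul, taylor_mul, taylor_taylor, taylor_eval, xyPoly, eval_add, eval_C, eval_X]
    push_cast
    rw [show (0 : ℂ) + (-(j + 1) + 1) = 0 + -j by ring]
    linear_combination (-(-1) ^ j * coef m c 0 * S.eval 0 * R.eval (0 + -(j : ℂ))) * hα

end Conditions

end Admissible

end DicyclicCBH

open DicyclicCBH
theorem mainTheorem4 (m : ℕ) [NeZero m] (c : MonoidAlgebra ℂ (Dic m))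
    (hcenter : c ∈ Subalgebra.center ℂ (MonoidAlgebra ℂ (Dic m)))
    (hcyclic : ∀ s : Dic m, s ∉ Subgroup.zpowers (gg m) → c.coeff s = 0)
    (hc0 : c.coeff 1 ≠ 0)
    (T : H m c →ₗ[ℂ] ℂ) :
    IsTrace m c T ↔
      -- (1) invariance under conjugation by the dicyclic group
      (∀ (s : Dic m) (a : H m c), T (grp m c s * a * grp m c s⁻¹) = T a) ∧
      -- (2)
      (∀ (i : ℕ) (R : ℂ[X]) (q : ℤ), i ≠ 0 →
        T (xH m c ^ i * aeval (K m c) R * E m c q) = 0 ∧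
        T (yH m c ^ i * aeval (K m c) R * E m c q) = 0) ∧
      -- (3)
      (∀ (i : ℕ) (R : ℂ[X]) (q : ℤ), ¬ 2 ∣ i →
        T (xH m c ^ i * aeval (K m c) R * E m c q * grp m c (hh m)) = 0 ∧
        T (yH m c ^ i * aeval (K m c) R * E m c q * grp m c (hh m)) = 0) ∧
      -- (4)
      (∀ (i : ℕ) (R S : ℂ[X]) (q : ℤ),
        xH m c ^ i * yH m c ^ i * E m c (q - i) = aeval (K m c) S * E m c (q - i) →
        T (xH m c ^ (2 * i) * aeval (K m c) R * E m c q * grp m c (hh m)) =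
          T (aeval (K m c) S * polyK m c R i * E m c (q - i) * grp m c (hh m))) ∧
      -- (5)
      (∀ (i : ℕ) (R S : ℂ[X]) (q : ℤ),
        yH m c ^ i * xH m c ^ i * E m c (q + i) = aeval (K m c) S * E m c (q + i) →
        T (yH m c ^ (2 * i) * aeval (K m c) R * E m c q * grp m c (hh m)) =
          (-1) ^ i * T (aeval (K m c) S * polyK m c R (-i) * E m c (q + i) * grp m c (hh m))) ∧
      -- (6)
      (∀ (i : ℕ) (q : ℤ), 0 < i → T (K m c ^ i * E m c q * grp m c (hh m)) = 0) ∧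
      -- (7) the shift condition
      (∀ (q : ℤ) (R : ℂ[X]),
        T ((K m c + algebraMap ℂ (H m c) (1 / 2 - alpha m c q)) * polyK m c R (1 / 2) *
            E m c q) =
          T ((K m c + algebraMap ℂ (H m c) (-(1 / 2) - alpha m c q)) * polyK m c R (-(1 / 2)) *
            E m c (q + 1))) ∧
      -- (8) the evenness condition
      (∀ (q : ℤ) (R : ℂ[X]),
        T (aeval (K m c) R * E m c q) = T (aeval (-K m c) R * E m c (-q))) := by
  have hc : IsAdmissible m c := ⟨hcenter, hcyclic, hc0⟩
  rw [shift_iff hc T]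
  constructor
  · intro hT
    exact ⟨hT.map_conj,
      fun i R q hi => ⟨hT.map_x_pow_eq_zero hc hi R q, hT.map_y_pow_eq_zero hc hi R q⟩,
      fun i R q hi => map_pow_mul_h_eq_zero hT.map_conj hi R q,
      hT.map_x_pow_two_mul hc, hT.map_y_pow_two_mul hc,
      fun i q hi => hT.map_K_pow_mul_E_mul_h hc hi q, hT.map_shift hc, hT.map_even hc⟩
  · rintro ⟨h1, h2, h3, h4, h5, h6, h7, -⟩
    refine isTrace_of_x_mul h1 fun b => ?_
    have hb := Submodule.mem_top (R := ℂ) (x := b)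
    rw [← span_normalForms_eq_top hc] at hb
    induction hb using Submodule.span_induction with
    | mem b hb =>
      obtain ⟨u, rfl | rfl, s, rfl | rfl, i, R, q, rfl⟩ := hb
      · rw [grp_one, mul_one]
        exact map_x_mul_x_pow (fun i R q hi => (h2 i R q hi).1) hc i R q
      · exact map_x_mul_x_pow_mul_h h3 h4 hc i R q
      · rw [grp_one, mul_one]
        exact map_x_mul_y_pow h2 h7 hc i R q
      · exact map_x_mul_y_pow_mul_h h1 h3 h5 h6 hc i R q
    | zero => rw [mul_zero, zero_mul]
    | add b d _ _ hb hd => rw [mul_add, add_mul, map_add, map_add, hb, hd]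
    | smul z b _ hb => rw [mul_smul_comm, smul_mul_assoc, map_smul, map_smul, hb]
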